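/- **Theorem 2 (uniqueness).** Let $\mathcal M(X)$ denote the positive Borel measures on $X$ with finite mass and bounded support, write $|\mu|$ for the mass of $\mu$ (and for the total variation of a signed measure), and let $B(0,R)$ be the ball of radius $R$ about $0$. For $\mu,\nu\in\mathcal M(\mathbb R^n)$ let $$W^g(\mu,\nu)=\inf\{|\mu-\tilde\mu|+|\nu-\tilde\nu|+W(\tilde\mu,\tilde\nu):\ \tilde\mu,\tilde\nu\in\mathcal M(\mathbb R^n),\ |\tilde\mu|=|\tilde\nu|\},$$ where $W(\tilde\mu,\tilde\nu)=\inf_\pi\int|x-y|\,d\pi(x,y)$ over all measures $\pi$ on $\mathbb R^n\times\mathbb R^n$ with marginals $\tilde\mu,\tilde\nu$. Let $V:\mathcal M(\mathbb R^n)\to\mathcal M(T\mathbb R^n)$, $T\mathbb R^n=\mathbb R^n\times\mathbb R^n$, be a probability vector field, i.e. the projection of $V[\mu]$ to the base space is $\mu$ for every $\mu$, and let $s:\mathcal M(\mathbb R^n)\to\mathcal M(\mathbb R^n)$. Assume * (V1) there is $C>0$ with $\sup_{(x,v)\in\mathrm{supp}(V[\mu])}|v|\le C\,(1+\sup_{x\in\mathrm{supp}(\mu)}|x|)$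 for all $\mu$; * (s1) there is $L$ with $W^g(s[\mu],s[\nu])\le L\,W^g(\mu,\nu)$ for all $\mu,\nu$; * (s2) there is $R$ with $\mathrm{supp}(s[\mu])\subset B(0,R)$ for all $\mu$. A *solution* on $[0,\tau]$ of $\dot\mu=V[\mu]\oplus s[\mu]$ is a $W^g$-continuous curve $\mu:[0,\tau]\to\mathcal M(\mathbb R^n)$ such that for each $f\in C_c^\infty(\mathbb R^n)$: $\int\nabla f(x)\cdot v\,dV[\mu(t)](x,v)$ is defined for a.e. $t$; $t\mapsto\int f\,ds[\mu(t)]$ is in $L^1([0,\tau])$; and $t\mapsto\int f\,d\mu(t)$ is absolutely continuous with $$\frac{d}{dt}\int f\,d\mu(t)=\int\nabla f(x)\cdot v\,dV[\mu(t)](x,v)+\int f\,ds[\mu(t)]\quad\text{for a.e. }t\in[0,\tau].$$ The equation $\dot\mu=V[\mu]$ is the case $s=0$. Fix $T>0$. A *Lipschitz semigroup of solutions* is a map $S:[0,T]\times\mathcal M(\mathbb R^n)\to\mathcal M(\mathbb R^n)$ such that: $S_0\mu=\mu$ and $S_{t+r}\mu=S_tS_r\mu$ whenever $t,r\ge0$,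 $t+r\le T$; each $t\mapsto S_t\mu$ is a solution of $\dot\mu=V[\mu]\oplus s[\mu]$ on $[0,T]$; and there is $R_0\ge0$ such that for all $R,M>0$ there is $C>0$ such that, whenever $\mathrm{supp}(\mu)\cup\mathrm{supp}(\nu)\subset B(0,R)$ and $|\mu|+|\nu|\le M$, for all $t,r\in[0,T]$: $\mathrm{supp}(S_t\mu)\subset B(0,e^{Ct}(R+M+1+R_0))$, $\;W^g(S_t\mu,S_t\nu)\le e^{Ct}W^g(\mu,\nu)$, $\;W^g(S_t\mu,S_r\mu)\le C|t-r|$. Let $\mathcal M^D$ be the set of finite sums $\sum_{l}m_l\delta_{x_l}$ with $m_l\ge0$, and $\mathcal M^D_{R,M}$ the set of those $\mu\in\mathcal M^D$ with $\mathrm{supp}(\mu)\subset B(0,R)$ and $|\mu|\le M$. A *Dirac germ* $\gamma$ assigns to each $\mu\in\mathcal M^D$ a number $\varepsilon(\mu)>0$ and a $W^g$-Lipschitz curve $\gamma_\mu:[0,\varepsilon(\mu)]\to\mathcal M(\mathbb R^n)$ with $\gamma_\mu(0)=\mu$, such that for each $R$, $\varepsilon$ is bounded below by a positive constant on $\{\mu\in\mathcal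 M^D:\mathrm{supp}(\mu)\subset B(0,R)\}$, and such that either all the $\gamma_\mu$ are solutions of $\dot\mu=V[\mu]\oplus s[\mu]$, or all the $\gamma_\mu$ are solutions of $\dot\mu=V[\mu]$. A semigroup $S$ is *compatible* with $\gamma$ if for all $R,M>0$ there is $C(R,M)$ such that, for all $t\in[0,T]$ with $t\le\inf_{\mu\in\mathcal M^D_{R,M}}\varepsilon(\mu)$, $$\sup_{\mu\in\mathcal M^D_{R,M}}W^g(S_t\mu,\gamma_\mu(t))\le C(R,M)\,t^2 .$$ Let $\gamma$ be a Dirac germ. Then there is at most one Lipschitz semigroup of solutions to $\dot\mu=V[\mu]\oplus s[\mu]$ on $[0,T]$ that is compatible with $\gamma$: if $S^1,S^2$ are two such semigroups, then $S^1_t\mu=S^2_t\mu$ for all $t\in[0,T]$ and $\mu\in\mathcal M(\mathbb R^n)$. -/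

import Mathlib

open MeasureTheory Set Filter Topology
open scoped ENNReal NNReal ContDiff

noncomputable section

namespace MDES

/-- `ℝⁿ` with the Euclidean norm. -/
abbrev E (n : ℕ) : Type := EuclideanSpace ℝ (Fin n)

/-- Positive Borel measures of finite mass and bounded support. -/
@[ext]
structure BMeasure (X : Type*) [PseudoMetricSpace X] [MeasurableSpace X] where
  toMeasure : Measure X
  isFinite : IsFiniteMeasure toMeasure
  bounded : Bornology.IsBounded toMeasure.support

namespace BMeasure

variable {X : Type*} [PseudoMetricSpace X] [MeasurableSpace X]

instance (μ : BMeasure X) : IsFiniteMeasure μ.toMeasure := μ.isFinite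

instance : Zero (BMeasure X) := ⟨⟨0, inferInstance, by simp⟩⟩

/-- The support of `μ`. -/
def supp (μ : BMeasure X) : Set X := μ.toMeasure.support

/-- The mass `|μ| = μ(X)`. -/
def mass (μ : BMeasure X) : ℝ≥0∞ := μ.toMeasure univ

end BMeasure

/-- `M(ℝⁿ)`. -/
abbrev M (n : ℕ) : Type := BMeasure (E n)

/-- `M(Tℝⁿ)`, with `Tℝⁿ = ℝⁿ × ℝⁿ`, a point being a pair (position, velocity). -/
abbrev TM (n : ℕ) : Type := BMeasure (E n × E n)

variable {n : ℕ}

/-- `|μ - ν|`, the total variation of the signed measure `μ - ν`. -/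
def tvDist (μ ν : M n) : ℝ≥0∞ :=
  (μ.toMeasure.toSignedMeasure - ν.toMeasure.toSignedMeasure).totalVariation univ

/-- Transference plans from `μ` to `ν`: measures on the product with marginals `μ` and `ν`. -/
def IsPlan (π : Measure (E n × E n)) (μ ν : M n) : Prop :=
  π.map Prod.fst = μ.toMeasure ∧ π.map Prod.snd = ν.toMeasure

/-- The Wasserstein distance with exponent `1` (meaningful for measures of equal mass). -/
def W (μ ν : M n) : ℝ≥0∞ :=
  ⨅ (π : Measure (E n × E n)) (_ : IsPlan π μ ν), ∫⁻ p, edist p.1 p.2 ∂π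

/-- The generalized Wasserstein distance. -/
def Wg (μ ν : M n) : ℝ≥0∞ :=
  ⨅ (μ' : M n) (ν' : M n) (_ : μ'.mass = ν'.mass), tvDist μ μ' + tvDist ν ν' + W μ' ν'

/-- Probability vector fields: the projection of `V[μ]` on the base space is `μ`. -/
def IsPVF (V : M n → TM n) : Prop :=
  ∀ μ, (V μ).toMeasure.map Prod.fst = μ.toMeasure

/-- (V1): support sublinearity. The supremum is over a bounded set; it is `0` for `μ = 0`, in
which case `V[μ] = 0` has empty support. -/
def SupportSublinear (V : M n → TM n) : Prop :=
  ∃ C > (0 : ℝ), ∀ μ : M n, ∀ p ∈ (V μ).supp,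
    ‖p.2‖ ≤ C * (1 + sSup ((fun x => ‖x‖) '' μ.supp))

/-- (s1): Lipschitz continuity of the source. -/
def SourceLipschitz (s : M n → M n) : Prop :=
  ∃ L : ℝ≥0, ∀ μ ν : M n, Wg (s μ) (s ν) ≤ L * Wg μ ν

/-- (s2): uniform boundedness of the support of the source. -/
def SourceBoundedSupport (s : M n → M n) : Prop :=
  ∃ R : ℝ, ∀ μ : M n, (s μ).supp ⊆ Metric.ball 0 R

/-- `μ : [0,T] → M(ℝⁿ)` is a solution to `dμ/dt = V[μ] ⊕ s[μ]`. Only the values of `μ` on `[0,T]`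
matter; `fderiv ℝ f x v` is `∇f(x)·v`. With `s = 0` this is the equation `dμ/dt = V[μ]`. -/
structure IsSolution (V : M n → TM n) (s : M n → M n) (T : ℝ) (μ : ℝ → M n) : Prop where
  continuous : ∀ t ∈ Icc 0 T, Tendsto (fun r => Wg (μ r) (μ t)) (𝓝[Icc 0 T] t) (𝓝 0)
  integrable : ∀ f : E n → ℝ, ContDiff ℝ ∞ f → HasCompactSupport f →
    ∀ᵐ τ ∂volume.restrict (Icc 0 T),
      Integrable (fun p : E n × E n => fderiv ℝ f p.1 p.2) (V (μ τ)).toMeasure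
  source_integrable : ∀ f : E n → ℝ, ContDiff ℝ ∞ f → HasCompactSupport f →
    IntegrableOn (fun τ => ∫ x, f x ∂(s (μ τ)).toMeasure) (Icc 0 T) volume
  absolutelyContinuous : ∀ f : E n → ℝ, ContDiff ℝ ∞ f → HasCompactSupport f →
    AbsolutelyContinuousOnInterval (fun t => ∫ x, f x ∂(μ t).toMeasure) 0 T
  weak_eq : ∀ f : E n → ℝ, ContDiff ℝ ∞ f → HasCompactSupport f →
    ∀ᵐ t ∂volume.restrict (Icc 0 T),
      HasDerivAt (fun t => ∫ x, f x ∂(μ t).toMeasure)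
        ((∫ p : E n × E n, fderiv ℝ f p.1 p.2 ∂(V (μ t)).toMeasure)
          + ∫ x, f x ∂(s (μ t)).toMeasure) t

/-- Lipschitz semigroups of solutions `S : [0,T] × M(ℝⁿ) → M(ℝⁿ)` (only times in `[0,T]` matter).
The radius `R₀` allows for sources that create mass outside the unit ball. -/
structure IsLipschitzSemigroup (V : M n → TM n) (s : M n → M n) (T : ℝ)
    (S : ℝ → M n → M n) : Prop where
  zero : ∀ μ, S 0 μ = μ
  add : ∀ t r : ℝ, 0 ≤ t → 0 ≤ r → t + r ≤ T → ∀ μ, S (t + r) μ = S t (S r μ)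
  solution : ∀ μ, IsSolution V s T (fun t => S t μ)
  bounds : ∃ R₀ : ℝ, 0 ≤ R₀ ∧ ∀ R > (0 : ℝ), ∀ m > (0 : ℝ), ∃ C > (0 : ℝ), ∀ μ ν : M n,
    μ.supp ∪ ν.supp ⊆ Metric.ball 0 R → μ.mass + ν.mass ≤ ENNReal.ofReal m →
      (∀ t ∈ Icc 0 T, (S t μ).supp ⊆ Metric.ball 0 (Real.exp (C * t) * (R + m + 1 + R₀))) ∧
      (∀ t ∈ Icc 0 T, Wg (S t μ) (S t ν) ≤ ENNReal.ofReal (Real.exp (C * t)) * Wg μ ν) ∧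
      (∀ t ∈ Icc 0 T, ∀ r ∈ Icc 0 T, Wg (S t μ) (S r μ) ≤ ENNReal.ofReal (C * |t - r|))

/-- Finite sums of Dirac masses. -/
def DiracSums (n : ℕ) : Set (M n) :=
  {μ | ∃ (k : ℕ) (c : Fin k → ℝ≥0) (x : Fin k → E n),
    μ.toMeasure = ∑ l, (c l : ℝ≥0∞) • Measure.dirac (x l)}

/-- Finite sums of Dirac masses with support in `B(0,R)` and mass at most `m`. -/
def DiracSumsBdd (n : ℕ) (R m : ℝ) : Set (M n) :=
  {μ | μ ∈ DiracSums n ∧ μ.supp ⊆ Metric.ball 0 R ∧ μ.mass ≤ ENNReal.ofReal m}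

/-- Dirac germs for `dμ/dt = V[μ] ⊕ s[μ]`: to each finite sum of Dirac masses `μ` a Lipschitz
solution `γ μ : [0, ε μ] → M(ℝⁿ)` starting at `μ` is assigned, with `ε` uniformly positive on
measures with uniformly bounded support. Values of `γ`, `ε` elsewhere are irrelevant. -/
structure IsDiracGerm (V : M n → TM n) (s : M n → M n) (ε : M n → ℝ) (γ : M n → ℝ → M n) :
    Prop where
  uniform_pos : ∀ R > (0 : ℝ), ∃ ε₀ > (0 : ℝ), ∀ μ ∈ DiracSums n,
    μ.supp ⊆ Metric.ball 0 R → ε₀ ≤ ε μ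
  lipschitz : ∀ μ ∈ DiracSums n, ∃ L : ℝ, ∀ t ∈ Icc 0 (ε μ), ∀ r ∈ Icc 0 (ε μ),
    Wg (γ μ t) (γ μ r) ≤ ENNReal.ofReal (L * |t - r|)
  init : ∀ μ ∈ DiracSums n, γ μ 0 = μ
  solution : ∀ μ ∈ DiracSums n, IsSolution V s (ε μ) (γ μ)

/-- Compatibility of the semigroup `S` on `[0,T]` with the germ `γ`: for `t ≤ T` not exceeding the
infimum of `ε` over `DiracSumsBdd n R m`, one has `Wg(S_t μ, γ_μ(t)) ≤ C(R,m) t²`. -/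
def IsCompatible (T : ℝ) (ε : M n → ℝ) (γ : M n → ℝ → M n) (S : ℝ → M n → M n) : Prop :=
  ∀ R > (0 : ℝ), ∀ m > (0 : ℝ), ∃ C : ℝ, ∀ t ∈ Icc 0 T,
    t ∈ lowerBounds (ε '' DiracSumsBdd n R m) →
      ∀ μ ∈ DiracSumsBdd n R m, Wg (S t μ) (γ μ t) ≤ ENNReal.ofReal (C * t ^ 2)

end MDES

end

namespace MDES

/-! ### Jordan decompositions, sub-plans and gluing -/

section General

variable {α : Type*} [MeasurableSpace α]

/-! The germ fixes a compatible semigroup up to O(h²) over a short time h, and this determines it.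
On Dirac sums both semigroups lie within O(h²) of the germ; Dirac sums are `Wg`-dense in each
bounded class and each time-h map is Lipschitz there, so the O(h²) bound passes to all measures of
the class (`exists_Wg_le_sq`). Splitting [0,t] into N steps and exchanging one semigroup for the
other step by step costs N · O((t/N)²), which tends to 0 (`eq_of_Wg_le_sq`).

This requires `Wg` to be a metric. The triangle inequality `Wg_triangle` rests on gluing plans along
a common part of the intermediate measures; separation, `eq_of_Wg_eq_zero`, rests on comparing
closed sets with their thickenings. -/

theorem measure_add_right_cancel {μ ν ρ : Measure α} [IsFiniteMeasure ρ]
    (h : μ + ρ = ν + ρ) : μ = ν := by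
  ext s hs
  have := congrArg (fun m : Measure α => m s) h
  simpa [ENNReal.add_left_inj (measure_ne_top ρ s)] using this

/-- If `μ - ν = b - a` for measures `a`, `b`, the positive part of `μ - ν` is at most `b` and the
negative part at most `a`. -/
theorem jordan_le_of_add_eq_add {μ ν a b : Measure α} [IsFiniteMeasure μ] [IsFiniteMeasure ν]
    (h : μ + a = ν + b) :
    (μ.toSignedMeasure - ν.toSignedMeasure).toJordanDecomposition.posPart ≤ b ∧
    (μ.toSignedMeasure - ν.toSignedMeasure).toJordanDecomposition.negPart ≤ a ∧
    μ + (μ.toSignedMeasure - ν.toSignedMeasure).toJordanDecomposition.negPart =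
      ν + (μ.toSignedMeasure - ν.toSignedMeasure).toJordanDecomposition.posPart := by
  set j := (μ.toSignedMeasure - ν.toSignedMeasure).toJordanDecomposition with hj
  have hjs : j.posPart.toSignedMeasure - j.negPart.toSignedMeasure =
      μ.toSignedMeasure - ν.toSignedMeasure :=
    SignedMeasure.toSignedMeasure_toJordanDecomposition _
  have h1 : μ + j.negPart = ν + j.posPart := by
    ext s hs
    have := congrArg (fun m : SignedMeasure α => m s) hjs
    simp only [Measure.toSignedMeasure_sub_apply hs] at this
    rw [Measure.add_apply, Measure.add_apply, ← ENNReal.toReal_eq_toReal_iff' (by finiteness)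
      (by finiteness), ENNReal.toReal_add (by finiteness) (by finiteness),
      ENNReal.toReal_add (by finiteness) (by finiteness)]
    simp only [Measure.real] at this
    linarith
  have h2 : j.posPart + a = b + j.negPart := by
    refine measure_add_right_cancel (ρ := ν) ?_
    calc j.posPart + a + ν = (ν + j.posPart) + a := by abel
      _ = (μ + a) + j.negPart := by rw [← h1]; abel
      _ = b + j.negPart + ν := by rw [h]; abel
  have h2' : ∀ s, j.posPart s + a s = b s + j.negPart s := fun s => by
    simpa using congrArg (fun m : Measure α => m s) h2
  -- The positive part vanishes on `S` and the negative part off `S`, so on each piece one term of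
  -- `h2'` drops out.
  obtain ⟨S, hS, -, -, hp, hn⟩ := j.exists_compl_positive_negative
  refine ⟨Measure.le_iff.2 fun s hs => ?_, Measure.le_iff.2 fun s hs => ?_, h1⟩
  · calc j.posPart s = j.posPart (s ∩ S) + j.posPart (s \ S) := (measure_inter_add_sdiff s hS).symm
      _ = j.posPart (s \ S) := by rw [measure_mono_null inter_subset_right hp, zero_add]
      _ ≤ b (s \ S) + j.negPart (s \ S) := by rw [← h2']; exact le_self_add
      _ = b (s \ S) := by rw [measure_mono_null (fun x hx => hx.2) hn, add_zero]
      _ ≤ b s := measure_mono sdiff_subset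
  · calc j.negPart s = j.negPart (s ∩ S) + j.negPart (s \ S) := (measure_inter_add_sdiff s hS).symm
      _ = j.negPart (s ∩ S) := by
        rw [measure_mono_null (show s \ S ⊆ Sᶜ from fun x hx => hx.2) hn, add_zero]
      _ ≤ b (s ∩ S) + j.negPart (s ∩ S) := le_add_self
      _ = a (s ∩ S) := by
        rw [← h2', measure_mono_null (show s ∩ S ⊆ S from inter_subset_right) hp, zero_add]
      _ ≤ a s := measure_mono inter_subset_left

/-- Two finite measures split as common part plus remainders whose masses sum to the total
variation of the difference. -/
theorem exists_common_part (μ ν : Measure α) [IsFiniteMeasure μ] [IsFiniteMeasure ν] :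
    ∃ ρ p q : Measure α, μ = ρ + p ∧ ν = ρ + q ∧
      (μ.toSignedMeasure - ν.toSignedMeasure).totalVariation univ = p univ + q univ := by
  -- Here `a = ν` and `b = μ`, which puts the positive part below `μ`.
  obtain ⟨hp, -, h⟩ := jordan_le_of_add_eq_add (add_comm μ ν)
  set j := (μ.toSignedMeasure - ν.toSignedMeasure).toJordanDecomposition
  have h1 : μ - j.posPart + j.posPart = μ := Measure.sub_add_cancel_of_le hp
  refine ⟨μ - j.posPart, j.posPart, j.negPart, h1.symm, ?_, rfl⟩
  refine measure_add_right_cancel (ρ := j.posPart) ?_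
  calc ν + j.posPart = (μ - j.posPart + j.posPart) + j.negPart := by rw [← h, h1]
    _ = μ - j.posPart + j.negPart + j.posPart := add_right_comm _ _ _

/-- Minimality of the Jordan decomposition. The additive form of `h` lets upper bounds on `tvDist`
be proved without subtracting measures. -/
theorem totalVariation_sub_le {μ ν a b : Measure α} [IsFiniteMeasure μ] [IsFiniteMeasure ν]
    (h : μ + a = ν + b) :
    (μ.toSignedMeasure - ν.toSignedMeasure).totalVariation univ ≤ a univ + b univ := by
  obtain ⟨hp, hq, -⟩ := jordan_le_of_add_eq_add h
  rw [SignedMeasure.totalVariation, Measure.add_apply, add_comm]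
  exact add_le_add (hq univ) (hp univ)

/-- A measure below the second marginal of `π` is the second marginal of a measure below `π`. -/
theorem exists_le_map_snd_eq {β : Type*} [MeasurableSpace β] {π : Measure (α × β)}
    [IsFiniteMeasure π] {ρ : Measure β} (h : ρ ≤ π.map Prod.snd) :
    ∃ π' ≤ π, π'.map Prod.snd = ρ := by
  have hρ : IsFiniteMeasure ρ := isFiniteMeasure_of_le _ h
  set f := ρ.rnDeriv (π.map Prod.snd)
  have hf : Measurable f := Measure.measurable_rnDeriv _ _
  -- The density of `ρ` with respect to the marginal is at most 1; pulled back to the product, it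
  -- cuts `π` down.
  refine ⟨π.withDensity (f ∘ Prod.snd), ?_, ?_⟩
  · have h1 : f ∘ Prod.snd ≤ᵐ[π] 1 :=
      ae_of_ae_map measurable_snd.aemeasurable (Measure.rnDeriv_le_one_of_le h)
    calc π.withDensity (f ∘ Prod.snd) ≤ π.withDensity 1 := withDensity_mono h1
      _ = π := withDensity_one
  · conv_rhs => rw [← Measure.withDensity_rnDeriv_eq ρ (π.map Prod.snd)
      (Measure.absolutelyContinuous_of_le h)]
    ext s hs
    rw [Measure.map_apply measurable_snd hs, withDensity_apply _ (measurable_snd hs),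
      withDensity_apply _ hs, setLIntegral_map hs hf measurable_snd]
    rfl

theorem exists_le_map_fst_eq {β : Type*} [MeasurableSpace β] {π : Measure (α × β)}
    [IsFiniteMeasure π] {ρ : Measure α} (h : ρ ≤ π.map Prod.fst) :
    ∃ π' ≤ π, π'.map Prod.fst = ρ := by
  have h' : ρ ≤ (π.map Prod.swap).map Prod.snd := by
    rw [Measure.map_map measurable_snd measurable_swap]; exact h
  obtain ⟨π', hle, hπ'⟩ := exists_le_map_snd_eq h'
  refine ⟨π'.map Prod.swap, ?_, ?_⟩
  · calc π'.map Prod.swap ≤ (π.map Prod.swap).map Prod.swap := Measure.map_mono hle measurable_swap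
      _ = π := by rw [Measure.map_map measurable_swap measurable_swap]; simp
  · rw [Measure.map_map measurable_fst measurable_swap]; exact hπ'

open ProbabilityTheory in
/-- Gluing of transference plans. -/
theorem exists_gluing {X Y Z : Type*} [MeasurableSpace X] [MeasurableSpace Y] [MeasurableSpace Z]
    [StandardBorelSpace X] [StandardBorelSpace Z] [Nonempty X] [Nonempty Z]
    {π₁ : Measure (X × Y)} {π₂ : Measure (Y × Z)} [IsFiniteMeasure π₁] [IsFiniteMeasure π₂]
    (h : π₁.map Prod.snd = π₂.map Prod.fst) :
    ∃ σ : Measure (Y × X × Z), σ.map (fun p => (p.2.1, p.1)) = π₁ ∧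
      σ.map (fun p => (p.1, p.2.2)) = π₂ := by
  set π₁' := π₁.map Prod.swap with hπ₁'
  have hm1 : π₁'.fst = π₂.fst := by
    rw [Measure.fst, Measure.fst, ← h, hπ₁', Measure.map_map measurable_fst measurable_swap]; rfl
  -- The outer coordinates are taken independent given the middle one, which is listed first.
  refine ⟨π₂.fst ⊗ₘ (π₁'.condKernel ×ₖ π₂.condKernel), ?_, ?_⟩
  · have h1 : (π₂.fst ⊗ₘ (π₁'.condKernel ×ₖ π₂.condKernel)).map (Prod.map id Prod.fst) = π₁' := by
      rw [← Measure.compProd_map measurable_fst, ← Kernel.fst_eq, Kernel.fst_prod, ← hm1]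
      exact π₁'.disintegrate _
    have h2 : π₁ = π₁'.map Prod.swap := by
      rw [hπ₁', Measure.map_map measurable_swap measurable_swap]; simp
    refine Eq.trans ?_ h2.symm
    conv_rhs => rw [← h1]
    rw [Measure.map_map measurable_swap (by fun_prop)]
    rfl
  · have h1 : (π₂.fst ⊗ₘ (π₁'.condKernel ×ₖ π₂.condKernel)).map (Prod.map id Prod.snd) = π₂ := by
      rw [← Measure.compProd_map measurable_snd, ← Kernel.snd_eq, Kernel.snd_prod]
      exact π₂.disintegrate _
    exact h1

end General

/-! ### `Wg` as a pseudometric -/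

variable {n : ℕ}

theorem tvDist_comm (μ ν : M n) : tvDist μ ν = tvDist ν μ := by
  rw [tvDist, tvDist, ← SignedMeasure.totalVariation_neg, neg_sub]

theorem tvDist_self (μ : M n) : tvDist μ μ = 0 := by
  simp [tvDist, SignedMeasure.totalVariation_zero]

theorem tvDist_triangle (μ ν ξ : M n) : tvDist μ ξ ≤ tvDist μ ν + tvDist ν ξ := by
  obtain ⟨ρ, p, q, hμ, hν, h⟩ := exists_common_part μ.toMeasure ν.toMeasure
  obtain ⟨ρ', p', q', hν', hξ, h'⟩ := exists_common_part ν.toMeasure ξ.toMeasure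
  have key : μ.toMeasure + (q + q') = ξ.toMeasure + (p + p') := by
    calc μ.toMeasure + (q + q') = (ρ + q) + p + q' := by rw [hμ]; abel
      _ = ξ.toMeasure + (p + p') := by rw [← hν, hν', hξ]; abel
  refine (totalVariation_sub_le key).trans_eq ?_
  rw [tvDist, tvDist, h, h', Measure.add_apply, Measure.add_apply]
  ring

theorem measure_le_add_tvDist (μ ν : M n) (A : Set (E n)) :
    μ.toMeasure A ≤ ν.toMeasure A + tvDist μ ν := by
  obtain ⟨ρ, p, q, hμ, hν, h⟩ := exists_common_part μ.toMeasure ν.toMeasure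
  rw [tvDist, h, hμ, hν, Measure.add_apply, Measure.add_apply]
  calc ρ A + p A ≤ ρ A + p univ := by gcongr; exact subset_univ A
    _ ≤ ρ A + q A + (p univ + q univ) := by
      gcongr
      · exact le_self_add
      · exact le_self_add

theorem IsPlan.isFiniteMeasure {π : Measure (E n × E n)} {μ ν : M n} (h : IsPlan π μ ν) :
    IsFiniteMeasure π := by
  constructor
  have : π univ = μ.toMeasure univ := by
    rw [← h.1, Measure.map_apply measurable_fst MeasurableSet.univ, preimage_univ]
  rw [this]
  exact measure_lt_top _ _

theorem IsPlan.mass_eq {π : Measure (E n × E n)} {μ ν : M n} (h : IsPlan π μ ν) :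
    μ.mass = ν.mass := by
  rw [BMeasure.mass, BMeasure.mass, ← h.1, ← h.2,
    Measure.map_apply measurable_fst MeasurableSet.univ,
    Measure.map_apply measurable_snd MeasurableSet.univ, preimage_univ, preimage_univ]

theorem IsPlan.swap {π : Measure (E n × E n)} {μ ν : M n} (h : IsPlan π μ ν) :
    IsPlan (π.map Prod.swap) ν μ := by
  constructor
  · rw [Measure.map_map measurable_fst measurable_swap]; exact h.2
  · rw [Measure.map_map measurable_snd measurable_swap]; exact h.1

theorem W_comm_le (μ ν : M n) : W μ ν ≤ W ν μ := by
  refine le_iInf₂ fun π hπ => (iInf₂_le (π.map Prod.swap) hπ.swap).trans_eq ?_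
  rw [lintegral_map (by fun_prop) measurable_swap]
  simp [edist_comm]

theorem W_comm (μ ν : M n) : W μ ν = W ν μ := (W_comm_le μ ν).antisymm (W_comm_le ν μ)

theorem Wg_comm_le (μ ν : M n) : Wg μ ν ≤ Wg ν μ := by
  refine le_iInf₂ fun μ' ν' => le_iInf fun h => ?_
  refine (iInf₂_le ν' μ').trans ((iInf_le _ h.symm).trans_eq ?_)
  rw [W_comm, add_comm (tvDist μ ν')]

theorem Wg_comm (μ ν : M n) : Wg μ ν = Wg ν μ := (Wg_comm_le μ ν).antisymm (Wg_comm_le ν μ)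

theorem Wg_le_of_isPlan {μ ν μ' ν' : M n} {π : Measure (E n × E n)} (h : IsPlan π μ' ν') :
    Wg μ ν ≤ tvDist μ μ' + tvDist ν ν' + ∫⁻ p, edist p.1 p.2 ∂π := by
  refine (iInf₂_le μ' ν').trans ((iInf_le _ h.mass_eq).trans ?_)
  gcongr
  exact iInf₂_le π h

/-- Near-optimal data suffice throughout, so no optimal plan has to exist. -/
theorem exists_isPlan_of_Wg_lt {μ ν : M n} {r : ℝ≥0∞} (h : Wg μ ν < r) :
    ∃ (μ' ν' : M n) (π : Measure (E n × E n)), IsPlan π μ' ν' ∧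
      tvDist μ μ' + tvDist ν ν' + ∫⁻ p, edist p.1 p.2 ∂π < r := by
  simp only [Wg, iInf_lt_iff] at h
  obtain ⟨μ', ν', -, h⟩ := h
  rw [W, ENNReal.add_iInf] at h
  simp only [iInf_lt_iff] at h
  obtain ⟨π, h⟩ := h
  by_cases hπ : IsPlan π μ' ν'
  · exact ⟨μ', ν', π, hπ, by simpa [hπ] using h⟩
  · simp [hπ] at h

theorem Wg_self (μ : M n) : Wg μ μ = 0 := by
  have h : IsPlan (μ.toMeasure.map fun x => (x, x)) μ μ := by
    constructor <;> rw [Measure.map_map (by fun_prop) (by fun_prop)] <;> exact Measure.map_id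
  refine le_antisymm ((Wg_le_of_isPlan h).trans_eq ?_) zero_le
  rw [lintegral_map (by fun_prop) (by fun_prop)]
  simp [tvDist_self]

/-- A measure dominated by an element of `M(ℝⁿ)`, as an element of `M(ℝⁿ)`. -/
def BMeasure.ofLE (μ : M n) (ρ : Measure (E n)) (h : ρ ≤ μ.toMeasure) : M n where
  toMeasure := ρ
  isFinite := isFiniteMeasure_of_le _ h
  bounded := μ.bounded.subset (Measure.support_mono h)

theorem tvDist_ofLE_le {μ : M n} {ρ : Measure (E n)} (h : ρ ≤ μ.toMeasure) {c : ℝ≥0∞}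
    (hmass : μ.toMeasure univ ≤ ρ univ + c) :
    tvDist μ (μ.ofLE ρ h) ≤ c := by
  have hρ : IsFiniteMeasure ρ := isFiniteMeasure_of_le _ h
  have hsub : μ.toMeasure - ρ + ρ = μ.toMeasure := Measure.sub_add_cancel_of_le h
  have h1 : μ.toMeasure + 0 = (μ.ofLE ρ h).toMeasure + (μ.toMeasure - ρ) := by
    rw [add_zero, add_comm]; exact hsub.symm
  refine (totalVariation_sub_le h1).trans ?_
  rw [Measure.coe_zero, Pi.zero_apply, zero_add, Measure.sub_apply MeasurableSet.univ h]
  exact tsub_le_iff_left.2 hmass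

/-- The intermediate measures `ν₁` and `ν₂` of two near-optimal choices may differ. Only their
common part `ρ` is carried through: both plans are cut down to `ρ` and glued. The discarded masses
`p univ` and `q univ` add up to `tvDist ν₁ ν₂`, which the variation terms at `ν` already pay for. -/
theorem Wg_triangle (μ ν ξ : M n) : Wg μ ξ ≤ Wg μ ν + Wg ν ξ := by
  refine le_of_forall_gt fun r hr => ?_
  obtain ⟨r₁, r₂, h₁, h₂, hr⟩ : ∃ r₁ r₂, Wg μ ν < r₁ ∧ Wg ν ξ < r₂ ∧ r₁ + r₂ < r := by
    obtain ⟨r₁, h₁, r₂, h₂, h⟩ := ENNReal.exists_add_lt_of_add_lt hr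
    exact ⟨r₁, r₂, h₁, h₂, h⟩
  refine lt_of_le_of_lt ?_ hr
  obtain ⟨μ', ν₁, π₁, hπ₁, hc₁⟩ := exists_isPlan_of_Wg_lt h₁
  obtain ⟨ν₂, ξ', π₂, hπ₂, hc₂⟩ := exists_isPlan_of_Wg_lt h₂
  have := hπ₁.isFiniteMeasure
  have := hπ₂.isFiniteMeasure
  obtain ⟨ρ, p, q, hp, hq, htv⟩ := exists_common_part ν₁.toMeasure ν₂.toMeasure
  obtain ⟨σ₁, hσ₁, hσ₁ρ⟩ := exists_le_map_snd_eq (π := π₁) (ρ := ρ)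
    (by rw [hπ₁.2, hp]; exact Measure.le_add_right le_rfl)
  obtain ⟨σ₂, hσ₂, hσ₂ρ⟩ := exists_le_map_fst_eq (π := π₂) (ρ := ρ)
    (by rw [hπ₂.1, hq]; exact Measure.le_add_right le_rfl)
  have := isFiniteMeasure_of_le _ hσ₁
  have := isFiniteMeasure_of_le _ hσ₂
  obtain ⟨σ, hσ1, hσ2⟩ := exists_gluing (hσ₁ρ.trans hσ₂ρ.symm)
  have hμ' : σ₁.map Prod.fst ≤ μ'.toMeasure := by
    rw [← hπ₁.1]; exact Measure.map_mono hσ₁ measurable_fst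
  have hξ' : σ₂.map Prod.snd ≤ ξ'.toMeasure := by
    rw [← hπ₂.2]; exact Measure.map_mono hσ₂ measurable_snd
  have hplan : IsPlan (σ.map Prod.snd) (μ'.ofLE _ hμ') (ξ'.ofLE _ hξ') := by
    constructor
    · change _ = σ₁.map Prod.fst
      rw [← hσ1, Measure.map_map (by fun_prop) (by fun_prop),
        Measure.map_map (by fun_prop) (by fun_prop)]
      rfl
    · change _ = σ₂.map Prod.snd
      rw [← hσ2, Measure.map_map (by fun_prop) (by fun_prop),
        Measure.map_map (by fun_prop) (by fun_prop)]
      rfl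
  have hcost : ∫⁻ x, edist x.1 x.2 ∂(σ.map Prod.snd) ≤
      ∫⁻ x, edist x.1 x.2 ∂π₁ + ∫⁻ x, edist x.1 x.2 ∂π₂ := by
    calc ∫⁻ x, edist x.1 x.2 ∂(σ.map Prod.snd) = ∫⁻ x, edist x.2.1 x.2.2 ∂σ :=
          lintegral_map (by fun_prop) measurable_snd
      _ ≤ ∫⁻ x, (edist x.2.1 x.1 + edist x.1 x.2.2) ∂σ :=
          lintegral_mono fun x => edist_triangle _ _ _
      _ = ∫⁻ x, edist x.2.1 x.1 ∂σ + ∫⁻ x, edist x.1 x.2.2 ∂σ :=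
          lintegral_add_left (by fun_prop) _
      _ = ∫⁻ x, edist x.1 x.2 ∂σ₁ + ∫⁻ x, edist x.1 x.2 ∂σ₂ := by
          rw [← hσ1, ← hσ2, lintegral_map (by fun_prop) (by fun_prop),
            lintegral_map (by fun_prop) (by fun_prop)]
      _ ≤ _ := add_le_add (lintegral_mono' hσ₁ le_rfl) (lintegral_mono' hσ₂ le_rfl)
  -- Plans preserve mass, so cutting `π₁` down to `ρ` removes from `μ'` exactly the mass of `p`.
  have hm₁ : tvDist μ' (μ'.ofLE _ hμ') ≤ p univ := by
    refine tvDist_ofLE_le hμ' ?_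
    have h1 := hπ₁.mass_eq
    rw [BMeasure.mass, BMeasure.mass, hp, Measure.add_apply, ← hσ₁ρ] at h1
    rw [h1, Measure.map_apply measurable_fst .univ, Measure.map_apply measurable_snd .univ]
    rfl
  have hm₂ : tvDist ξ' (ξ'.ofLE _ hξ') ≤ q univ := by
    refine tvDist_ofLE_le hξ' ?_
    have h1 := hπ₂.mass_eq
    rw [BMeasure.mass, BMeasure.mass, hq, Measure.add_apply, ← hσ₂ρ] at h1
    rw [← h1, Measure.map_apply measurable_fst .univ, Measure.map_apply measurable_snd .univ]
    rfl
  have hpq : p univ + q univ ≤ tvDist ν ν₁ + tvDist ν ν₂ := by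
    rw [← htv, tvDist_comm ν ν₁]; exact tvDist_triangle ν₁ ν ν₂
  calc Wg μ ξ ≤ tvDist μ (μ'.ofLE _ hμ') + tvDist ξ (ξ'.ofLE _ hξ') + _ := Wg_le_of_isPlan hplan
    _ ≤ (tvDist μ μ' + p univ) + (tvDist ξ ξ' + q univ) +
        (∫⁻ x, edist x.1 x.2 ∂π₁ + ∫⁻ x, edist x.1 x.2 ∂π₂) := by
      gcongr
      · exact (tvDist_triangle _ _ _).trans (by gcongr)
      · exact (tvDist_triangle _ _ _).trans (by gcongr)
    _ = tvDist μ μ' + tvDist ξ ξ' + (p univ + q univ) +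
        (∫⁻ x, edist x.1 x.2 ∂π₁ + ∫⁻ x, edist x.1 x.2 ∂π₂) := by ring
    _ ≤ tvDist μ μ' + tvDist ξ ξ' + (tvDist ν ν₁ + tvDist ν ν₂) +
        (∫⁻ x, edist x.1 x.2 ∂π₁ + ∫⁻ x, edist x.1 x.2 ∂π₂) := by gcongr
    _ = (tvDist μ μ' + tvDist ν ν₁ + ∫⁻ x, edist x.1 x.2 ∂π₁) +
        (tvDist ν ν₂ + tvDist ξ ξ' + ∫⁻ x, edist x.1 x.2 ∂π₂) := by ring
    _ ≤ r₁ + r₂ := add_le_add hc₁.le hc₂.le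

/-- Transport keeps mass; only the variation terms change it. This turns Lipschitz continuity in
time into a mass bound along orbits. -/
theorem mass_le_add_Wg (μ ν : M n) : μ.mass ≤ ν.mass + Wg μ ν := by
  simp only [Wg, ENNReal.add_iInf]
  refine le_iInf₂ fun μ' ν' => le_iInf fun h => ?_
  calc μ.mass ≤ μ'.mass + tvDist μ μ' := measure_le_add_tvDist μ μ' univ
    _ ≤ ν.mass + tvDist ν' ν + tvDist μ μ' := by
      rw [h]; gcongr; exact measure_le_add_tvDist ν' ν univ
    _ = ν.mass + (tvDist μ μ' + tvDist ν ν') := by rw [tvDist_comm ν']; ring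
    _ ≤ _ := add_le_add_right le_self_add _

/-! ### Separation of points by `Wg` -/

/-- The measure of a set is controlled by the measure of its thickenings, up to the distance `Wg`. -/
theorem measure_le_thickening_add {μ ν : M n} {A : Set (E n)} (hA : MeasurableSet A)
    {δ : ℝ} (hδ : 0 < δ) {r : ℝ≥0∞} (h : Wg μ ν < r) :
    μ.toMeasure A ≤ ν.toMeasure (Metric.thickening δ A) + (r + r / ENNReal.ofReal δ) := by
  obtain ⟨μ', ν', π, hπ, hc⟩ := exists_isPlan_of_Wg_lt h
  have hδ0 : ENNReal.ofReal δ ≠ 0 := by simpa using hδ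
  have hAt : MeasurableSet (Metric.thickening δ A) := Metric.isOpen_thickening.measurableSet
  have h1 : μ'.toMeasure A ≤ ν'.toMeasure (Metric.thickening δ A) +
      (∫⁻ p, edist p.1 p.2 ∂π) / ENNReal.ofReal δ := by
    rw [← hπ.1, ← hπ.2, Measure.map_apply measurable_fst hA, Measure.map_apply measurable_snd hAt]
    -- Mass leaving `A` either moves less than `δ` and stays in the thickening, or is bounded by
    -- Markov's inequality.
    have hsub : (Prod.fst ⁻¹' A : Set (E n × E n)) ⊆
        Prod.snd ⁻¹' (Metric.thickening δ A) ∪ {p | ENNReal.ofReal δ ≤ edist p.1 p.2} := by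
      rintro ⟨x, y⟩ hx
      by_cases hxy : ENNReal.ofReal δ ≤ edist x y
      · exact Or.inr hxy
      · refine Or.inl (Metric.mem_thickening_iff.2 ⟨x, hx, ?_⟩)
        rw [dist_comm]
        exact edist_lt_ofReal.1 (not_le.1 hxy)
    refine (measure_mono hsub).trans ((measure_union_le _ _).trans ?_)
    gcongr
    exact meas_ge_le_lintegral_div (by fun_prop) hδ0 ENNReal.ofReal_ne_top
  calc μ.toMeasure A ≤ μ'.toMeasure A + tvDist μ μ' := measure_le_add_tvDist _ _ _
    _ ≤ (ν.toMeasure (Metric.thickening δ A) + tvDist ν' ν +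
        (∫⁻ p, edist p.1 p.2 ∂π) / ENNReal.ofReal δ) + tvDist μ μ' := by
      gcongr
      refine h1.trans ?_
      gcongr
      exact measure_le_add_tvDist _ _ _
    _ = ν.toMeasure (Metric.thickening δ A) + ((tvDist μ μ' + tvDist ν ν') +
        (∫⁻ p, edist p.1 p.2 ∂π) / ENNReal.ofReal δ) := by rw [tvDist_comm ν']; ring
    _ ≤ _ := by
      gcongr
      · exact le_self_add.trans hc.le
      · exact le_add_self.trans hc.le

/-- In the thickening estimate, `r → 0` at fixed `δ`, and then `δ → 0`, where closedness of `A`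
enters. -/
theorem measure_le_of_Wg_eq_zero {μ ν : M n} (h : Wg μ ν = 0) {A : Set (E n)} (hA : IsClosed A) :
    μ.toMeasure A ≤ ν.toMeasure A := by
  have key : ∀ δ > 0, μ.toMeasure A ≤ ν.toMeasure (Metric.thickening δ A) := by
    intro δ hδ
    have hδ0 : ENNReal.ofReal δ ≠ 0 := by simpa using hδ
    have hlim : Tendsto (fun r : ℝ≥0∞ => ν.toMeasure (Metric.thickening δ A) +
        (r + r / ENNReal.ofReal δ)) (𝓝[>] 0) (𝓝 (ν.toMeasure (Metric.thickening δ A) +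
        (0 + 0 / ENNReal.ofReal δ))) := by
      refine Tendsto.mono_left ?_ nhdsWithin_le_nhds
      exact tendsto_const_nhds.add (tendsto_id.add (ENNReal.Tendsto.div_const tendsto_id
        (Or.inr hδ0)))
    simp only [ENNReal.zero_div, add_zero] at hlim
    refine ge_of_tendsto hlim (eventually_mem_nhdsWithin.mono fun r hr => ?_)
    exact measure_le_thickening_add hA.measurableSet hδ (h ▸ hr)
  have hlim := tendsto_measure_thickening_of_isClosed (μ := ν.toMeasure) (s := A)
    ⟨1, one_pos, measure_ne_top _ _⟩ hA
  exact ge_of_tendsto hlim (eventually_mem_nhdsWithin.mono fun δ hδ => key δ hδ)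

theorem eq_of_Wg_eq_zero {μ ν : M n} (h : Wg μ ν = 0) : μ = ν := by
  have hcl : ∀ A : Set (E n), IsClosed A → μ.toMeasure A = ν.toMeasure A := fun A hA =>
    (measure_le_of_Wg_eq_zero h hA).antisymm (measure_le_of_Wg_eq_zero (Wg_comm μ ν ▸ h) hA)
  refine BMeasure.ext (ext_of_generate_finite {s | IsClosed s} ?_ isPiSystem_isClosed
    (fun s hs => hcl s hs) (hcl univ isClosed_univ))
  rw [BorelSpace.measurable_eq (α := E n), borel_eq_generateFrom_isClosed]

/-! ### Density of Dirac sums -/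

/-- The image of a finite measure under a simple function is a finite sum of Dirac masses. -/
theorem mem_diracSums_of_eq_map {μ : M n} {ρ : Measure (E n)} [IsFiniteMeasure ρ]
    (φ : SimpleFunc (E n) (E n)) (h : μ.toMeasure = ρ.map φ) : μ ∈ DiracSums n := by
  let e := φ.range.equivFin.symm
  refine ⟨φ.range.card, fun l => (ρ (φ ⁻¹' {(e l : E n)})).toNNReal, fun l => e l, ?_⟩
  have h1 : (∑ l, ((ρ (φ ⁻¹' {(e l : E n)})).toNNReal : ℝ≥0∞) • Measure.dirac (e l : E n)) =
      ∑ y ∈ φ.range, ρ (φ ⁻¹' {y}) • Measure.dirac y := by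
    simp only [ENNReal.coe_toNNReal (measure_ne_top ρ _)]
    rw [← Finset.sum_coe_sort φ.range]
    exact Equiv.sum_comp e (fun y : φ.range => ρ (φ ⁻¹' {(y : E n)}) • Measure.dirac (y : E n))
  rw [h1, h]
  ext s hs
  have h2 : ρ (φ ⁻¹' s) = ∑ y ∈ φ.range, s.indicator 1 y * ρ (φ ⁻¹' {y}) := by
    rw [← SimpleFunc.map_lintegral, ← SimpleFunc.lintegral_eq_lintegral,
      ← lintegral_indicator_one (φ.measurable hs)]
    rfl
  rw [Measure.map_apply φ.measurable hs, h2]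
  simp [Measure.finsetSum_apply, Measure.dirac_apply' _ hs, mul_comm]

/-- Approximation by finite sums of Dirac masses with the same mass and support in the same ball. -/
theorem exists_diracSumsBdd_Wg_lt {μ : M n} {R m : ℝ} (hR : 0 < R)
    (hsupp : μ.supp ⊆ Metric.ball 0 R) (hm : μ.mass ≤ ENNReal.ofReal m) {η : ℝ≥0∞} (hη : 0 < η) :
    ∃ ν ∈ DiracSumsBdd n R m, Wg μ ν < η := by
  have hae : ∀ᵐ x ∂μ.toMeasure, x ∈ Metric.ball (0 : E n) R :=
    Filter.mem_of_superset Measure.support_mem_ae hsupp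
  have h0 : (0 : E n) ∈ Metric.ball (0 : E n) R := Metric.mem_ball_self hR
  have hfin : HasFiniteIntegral (fun x : E n => id x - 0) μ.toMeasure := by
    refine HasFiniteIntegral.of_bounded (C := R) (hae.mono fun x hx => ?_)
    simpa using (mem_ball_zero_iff.1 hx).le
  -- The identity is approximated by simple functions `φ` with values in the ball; the L¹ error is
  -- the cost of the plan `x ↦ (x, φ x)`.
  have hlim := SimpleFunc.tendsto_approxOn_L1_enorm (f := fun x : E n => x) (μ := μ.toMeasure)
    measurable_id h0 (hae.mono fun x hx => subset_closure hx) hfin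
  obtain ⟨k, hk⟩ := ((tendsto_order.1 hlim).2 η hη).exists
  set φ := SimpleFunc.approxOn (fun x : E n => x) measurable_id (Metric.ball 0 R) 0 h0 k
  have hφ : Measurable φ := φ.measurable
  have hφR : (φ.range : Set (E n)) ⊆ Metric.ball 0 R := by
    intro y hy
    obtain ⟨x, rfl⟩ := SimpleFunc.mem_range.1 hy
    exact SimpleFunc.approxOn_mem _ _ _ _
  have hsub : (μ.toMeasure.map φ).support ⊆ φ.range := by
    refine Measure.support_subset_of_isClosed φ.range.finite_toSet.isClosed ?_
    rw [mem_ae_map_iff hφ.aemeasurable φ.range.measurableSet]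
    exact Filter.Eventually.of_forall fun x => SimpleFunc.mem_range_self φ x
  let ν : M n := ⟨μ.toMeasure.map φ, inferInstance, φ.range.finite_toSet.isBounded.subset hsub⟩
  refine ⟨ν, ⟨?_, hsub.trans hφR, ?_⟩, ?_⟩
  · exact mem_diracSums_of_eq_map φ rfl
  · refine le_trans (le_of_eq ?_) hm
    exact (Measure.map_apply hφ .univ)
  · have hplan : IsPlan (μ.toMeasure.map fun x => (x, φ x)) μ ν := by
      constructor <;> rw [Measure.map_map (by fun_prop) (by fun_prop)]
      · exact Measure.map_id
      · rfl
    refine (Wg_le_of_isPlan hplan).trans_lt ?_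
    rw [lintegral_map (by fun_prop) (by fun_prop), tvDist_self, tvDist_self, zero_add, zero_add]
    refine lt_of_eq_of_lt (lintegral_congr fun x => ?_) hk
    rw [edist_comm, edist_eq_enorm_sub]

/-! ### Bounded classes and comparison of semigroups -/

variable {V : M n → TM n} {s : M n → M n} {T : ℝ} {S S₁ S₂ : ℝ → M n → M n}

/-- Measures with support in `B(0,R)` and mass at most `m`. -/
def BddMeasures (n : ℕ) (R m : ℝ) : Set (M n) :=
  {μ | μ.supp ⊆ Metric.ball 0 R ∧ μ.mass ≤ ENNReal.ofReal m}

theorem BddMeasures.mono {R R' m m' : ℝ} (hR : R ≤ R') (hm : m ≤ m') :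
    BddMeasures n R m ⊆ BddMeasures n R' m' := fun _ h =>
  ⟨h.1.trans (Metric.ball_subset_ball hR), h.2.trans (ENNReal.ofReal_le_ofReal hm)⟩

theorem exists_mem_bddMeasures (μ : M n) : ∃ R > 0, ∃ m > 0, μ ∈ BddMeasures n R m := by
  obtain ⟨R, hR⟩ := μ.bounded.subset_ball 0
  refine ⟨max R 1, by positivity, μ.mass.toReal + 1, by positivity,
    hR.trans (Metric.ball_subset_ball (le_max_left _ _)), ?_⟩
  rw [ENNReal.ofReal_add (by positivity) zero_le_one,
    ENNReal.ofReal_toReal (a := μ.mass) (measure_ne_top μ.toMeasure univ)]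
  exact le_self_add

theorem add_mass_le {R m : ℝ} (hm : 0 < m) {μ ν : M n} (hμ : μ ∈ BddMeasures n R m)
    (hν : ν ∈ BddMeasures n R m) : μ.mass + ν.mass ≤ ENNReal.ofReal (2 * m) := by
  rw [two_mul, ENNReal.ofReal_add hm.le hm.le]
  exact add_le_add hμ.2 hν.2

/-- Orbits starting from a bounded class of measures stay in a bounded class. -/
theorem IsLipschitzSemigroup.exists_orbit_bound (hS : IsLipschitzSemigroup V s T S)
    {R m : ℝ} (hR : 0 < R) (hm : 0 < m) :
    ∃ R' ≥ R, ∃ m' ≥ m, ∀ μ ∈ BddMeasures n R m, ∀ t ∈ Icc 0 T, S t μ ∈ BddMeasures n R' m' := by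
  obtain ⟨R₀, hR₀, hb⟩ := hS.bounds
  -- The semigroup bounds involve the sum of two masses, hence `2 * m`. The maxima below give `R' ≥
  -- R` and `m' ≥ m` without a sign condition on `T`.
  obtain ⟨C, hC, hb⟩ := hb R hR (2 * m) (by positivity)
  refine ⟨max R (Real.exp (C * T) * (R + 2 * m + 1 + R₀)), le_max_left _ _,
    max m (m + C * T), le_max_left _ _, fun μ hμ t ht => ?_⟩
  obtain ⟨h1, -, h3⟩ := hb μ μ (union_subset hμ.1 hμ.1) (add_mass_le hm hμ hμ)
  have hT : 0 ≤ T := ht.1.trans ht.2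
  refine ⟨(h1 t ht).trans (Metric.ball_subset_ball (le_max_of_le_right ?_)), ?_⟩
  · gcongr
    exact ht.2
  · have h4 := h3 t ht 0 ⟨le_rfl, hT⟩
    rw [hS.zero, sub_zero, abs_of_nonneg ht.1] at h4
    calc (S t μ).mass ≤ μ.mass + Wg (S t μ) μ := mass_le_add_Wg _ _
      _ ≤ ENNReal.ofReal m + ENNReal.ofReal (C * T) := by
        refine add_le_add hμ.2 (h4.trans (ENNReal.ofReal_le_ofReal ?_))
        gcongr
        exact ht.2
      _ = ENNReal.ofReal (m + C * T) := (ENNReal.ofReal_add hm.le (by positivity)).symm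
      _ ≤ _ := ENNReal.ofReal_le_ofReal (le_max_right _ _)

/-- The semigroup is Lipschitz on bounded classes, uniformly in time. -/
theorem IsLipschitzSemigroup.exists_lipschitz (hS : IsLipschitzSemigroup V s T S)
    {R m : ℝ} (hR : 0 < R) (hm : 0 < m) :
    ∃ K : ℝ≥0, ∀ μ ∈ BddMeasures n R m, ∀ ν ∈ BddMeasures n R m, ∀ t ∈ Icc 0 T,
      Wg (S t μ) (S t ν) ≤ K * Wg μ ν := by
  obtain ⟨R₀, hR₀, hb⟩ := hS.bounds
  obtain ⟨C, hC, hb⟩ := hb R hR (2 * m) (by positivity)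
  refine ⟨(Real.exp (C * T)).toNNReal, fun μ hμ ν hν t ht => ?_⟩
  obtain ⟨-, h2, -⟩ := hb μ ν (union_subset hμ.1 hν.1) (add_mass_le hm hμ hν)
  refine (h2 t ht).trans (mul_le_mul_left (ENNReal.ofReal_le_ofReal ?_) _)
  gcongr
  exact ht.2

/-- Two semigroups compatible with the same germ agree to second order in time, uniformly on
bounded classes. -/
theorem exists_Wg_le_sq (hS₁ : IsLipschitzSemigroup V s T S₁) (hS₂ : IsLipschitzSemigroup V s T S₂)
    {ε : M n → ℝ} {γ : M n → ℝ → M n}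
    (hε : ∀ R > (0 : ℝ), ∃ ε₀ > (0 : ℝ), ∀ μ ∈ DiracSums n, μ.supp ⊆ Metric.ball 0 R → ε₀ ≤ ε μ)
    (hc₁ : IsCompatible T ε γ S₁) (hc₂ : IsCompatible T ε γ S₂)
    {R m : ℝ} (hR : 0 < R) (hm : 0 < m) :
    ∃ h₀ > 0, ∃ K : ℝ≥0, ∀ μ ∈ BddMeasures n R m, ∀ h ∈ Icc 0 T, h ≤ h₀ →
      Wg (S₁ h μ) (S₂ h μ) ≤ K * ENNReal.ofReal (h ^ 2) := by
  obtain ⟨h₀, hh₀, hε₀⟩ := hε R hR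
  obtain ⟨C₁, hC₁⟩ := hc₁ R hR m hm
  obtain ⟨C₂, hC₂⟩ := hc₂ R hR m hm
  obtain ⟨K₁, hK₁⟩ := hS₁.exists_lipschitz hR hm
  obtain ⟨K₂, hK₂⟩ := hS₂.exists_lipschitz hR hm
  refine ⟨h₀, hh₀, C₁.toNNReal + C₂.toNNReal, fun μ hμ h hh hle => ?_⟩
  have hlb : h ∈ lowerBounds (ε '' DiracSumsBdd n R m) := by
    rintro _ ⟨ν, hν, rfl⟩
    exact hle.trans (hε₀ ν hν.1 hν.2.1)
  have hsq : ∀ C : ℝ, ENNReal.ofReal (C * h ^ 2) = C.toNNReal * ENNReal.ofReal (h ^ 2) :=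
    fun C => ENNReal.ofReal_mul' (sq_nonneg h)
  set c : ℝ≥0∞ := ((C₁.toNNReal + C₂.toNNReal : ℝ≥0) : ℝ≥0∞) * ENNReal.ofReal (h ^ 2) with hc
  -- With `h` fixed, the accuracy `η` of the Dirac approximation is free, so its contribution
  -- disappears in the limit.
  have key : ∀ η : ℝ≥0∞, 0 < η → Wg (S₁ h μ) (S₂ h μ) ≤ c + (K₁ + K₂) * η := by
    intro η hη
    obtain ⟨ν, hν, hμν⟩ := exists_diracSumsBdd_Wg_lt hR hμ.1 hμ.2 hη
    have h1 := hK₁ μ hμ ν hν.2 h hh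
    have h2 := hK₂ ν hν.2 μ hμ h hh
    have h3 := hC₁ h hh hlb ν hν
    have h4 := hC₂ h hh hlb ν hν
    rw [hsq] at h3 h4
    calc Wg (S₁ h μ) (S₂ h μ)
        ≤ Wg (S₁ h μ) (S₁ h ν) + (Wg (S₁ h ν) (γ ν h) + (Wg (γ ν h) (S₂ h ν) +
          Wg (S₂ h ν) (S₂ h μ))) := by
          refine (Wg_triangle _ (S₁ h ν) _).trans (add_le_add_right ?_ _)
          refine (Wg_triangle _ (γ ν h) _).trans (add_le_add_right ?_ _)
          exact Wg_triangle _ _ _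
      _ ≤ K₁ * η + (C₁.toNNReal * ENNReal.ofReal (h ^ 2) + (C₂.toNNReal * ENNReal.ofReal (h ^ 2) +
          K₂ * η)) := by
          gcongr
          · exact h1.trans (by gcongr)
          · rwa [Wg_comm]
          · rw [Wg_comm] at hμν
            exact h2.trans (by gcongr)
      _ = c + (K₁ + K₂) * η := by rw [hc]; push_cast; ring
  have hlim : Tendsto (fun η : ℝ≥0∞ => c + (K₁ + K₂) * η) (𝓝[>] 0) (𝓝 (c + (K₁ + K₂) * 0)) := by
    refine Tendsto.mono_left ?_ nhdsWithin_le_nhds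
    exact tendsto_const_nhds.add (ENNReal.Tendsto.const_mul tendsto_id (Or.inr (by finiteness)))
  rw [mul_zero, add_zero] at hlim
  exact ge_of_tendsto hlim (eventually_mem_nhdsWithin.mono fun η hη => key η hη)

/-- Semigroups that agree to second order in time on bounded classes agree: the difference of the
orbits over `N` steps of length `t / N` is `O(1 / N)`. -/
theorem eq_of_Wg_le_sq (hS₁ : IsLipschitzSemigroup V s T S₁) (hS₂ : IsLipschitzSemigroup V s T S₂)
    (hloc : ∀ R > (0 : ℝ), ∀ m > (0 : ℝ), ∃ h₀ > (0 : ℝ), ∃ K : ℝ≥0,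
      ∀ μ ∈ BddMeasures n R m, ∀ h ∈ Icc 0 T, h ≤ h₀ →
        Wg (S₁ h μ) (S₂ h μ) ≤ K * ENNReal.ofReal (h ^ 2))
    {t : ℝ} (ht : t ∈ Icc 0 T) (μ : M n) : S₁ t μ = S₂ t μ := by
  obtain ⟨R, hR, m, hm, hμ⟩ := exists_mem_bddMeasures μ
  obtain ⟨R', hR', m', hm', horb⟩ := hS₂.exists_orbit_bound hR hm
  have hR'0 : 0 < R' := hR.trans_le hR'
  have hm'0 : 0 < m' := hm.trans_le hm'
  -- A second enlargement: one `S₁` step from the `S₂` orbit may leave the class `R', m'`. The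
  -- Lipschitz constant `L` is taken on the larger class, the local constant `K` on the smaller.
  obtain ⟨R₁, hR₁, m₁, hm₁, horb₁⟩ := hS₁.exists_orbit_bound hR'0 hm'0
  obtain ⟨L, hL⟩ := hS₁.exists_lipschitz (hR'0.trans_le hR₁) (hm'0.trans_le hm₁)
  obtain ⟨h₀, hh₀, K, hK⟩ := hloc R' hR'0 m' hm'0
  have key : ∀ N : ℕ, 0 < N → t / N ≤ h₀ →
      Wg (S₁ t μ) (S₂ t μ) ≤ N * (L * (K * ENNReal.ofReal ((t / N) ^ 2))) := by
    intro N hN hle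
    set h := t / N with hh
    have hNh : N * h = t := by rw [hh]; field_simp
    have hh0 : 0 ≤ h := div_nonneg ht.1 N.cast_nonneg
    have hmem : ∀ k : ℕ, k ≤ N → (k : ℝ) * h ∈ Icc 0 T := fun k hk =>
      ⟨by positivity, le_trans (by rw [← hNh]; gcongr) ht.2⟩
    -- Hybrid orbits: `k` steps of `S₂`, then `j` of `S₁`. Induction on `k` exchanges one step at a
    -- time.
    have hstep : ∀ j k : ℕ, j + k = N → Wg (S₁ t μ) (S₁ (j * h) (S₂ (k * h) μ)) ≤
        k * (L * (K * ENNReal.ofReal (h ^ 2))) := by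
      intro j k
      induction k generalizing j with
      | zero =>
        intro hjk
        rw [add_zero] at hjk
        rw [hjk, hNh, Nat.cast_zero, zero_mul, hS₂.zero, Wg_self]
        exact zero_le
      | succ k ih =>
        intro hjk
        have hjT := hmem j (by omega)
        have hkT := hmem k (by omega)
        have hhT : h ∈ Icc 0 T := by simpa using hmem 1 hN
        set ν := S₂ (k * h) μ with hν
        have hνb : ν ∈ BddMeasures n R' m' := horb μ hμ _ hkT
        have hsum1 : ((j + 1 : ℕ) : ℝ) * h = j * h + h := by push_cast; ring
        have hsum2 : ((k + 1 : ℕ) : ℝ) * h = h + k * h := by push_cast; ring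
        have e1 : S₁ ((j + 1 : ℕ) * h) ν = S₁ (j * h) (S₁ h ν) := by
          rw [hsum1, hS₁.add _ _ hjT.1 hh0 (hsum1 ▸ (hmem (j + 1) (by omega)).2)]
        have e2 : S₂ ((k + 1 : ℕ) * h) μ = S₂ h ν := by
          rw [hsum2, hS₂.add _ _ hh0 hkT.1 (hsum2 ▸ (hmem (k + 1) (by omega)).2)]
        have hb2 : S₂ h ν ∈ BddMeasures n R₁ m₁ := by
          rw [← e2]
          exact BddMeasures.mono hR₁ hm₁ (horb μ hμ _ (hmem (k + 1) (by omega)))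
        calc Wg (S₁ t μ) (S₁ (j * h) (S₂ ((k + 1 : ℕ) * h) μ))
            ≤ Wg (S₁ t μ) (S₁ ((j + 1 : ℕ) * h) ν) +
              Wg (S₁ ((j + 1 : ℕ) * h) ν) (S₁ (j * h) (S₂ ((k + 1 : ℕ) * h) μ)) :=
              Wg_triangle _ _ _
          _ ≤ k * (L * (K * ENNReal.ofReal (h ^ 2))) + L * (K * ENNReal.ofReal (h ^ 2)) := by
              refine add_le_add (ih (j + 1) (by omega)) ?_
              rw [e1, e2]
              -- The remaining time `j * h` is run in one go, so each local error is multiplied by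
              -- `L` once rather than by a power of `L`.
              refine (hL _ (horb₁ ν hνb h hhT) _ hb2 _ hjT).trans ?_
              gcongr
              exact hK ν hνb h hhT hle
          _ = _ := by push_cast; ring
    have := hstep 0 N (zero_add N)
    rwa [Nat.cast_zero, zero_mul, hS₁.zero, hNh] at this
  have hle : ∀ᶠ N : ℕ in atTop, t / N ≤ h₀ :=
    (tendsto_const_div_atTop_nhds_zero_nat t).eventually_le_const hh₀
  have hbound : ∀ᶠ N : ℕ in atTop, Wg (S₁ t μ) (S₂ t μ) ≤ ENNReal.ofReal (L * K * t ^ 2 / N) := by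
    filter_upwards [hle, eventually_gt_atTop 0] with N h1 h2
    refine (key N h2 h1).trans_eq ?_
    rw [← ENNReal.ofReal_natCast N, ← ENNReal.ofReal_coe_nnreal (p := L),
      ← ENNReal.ofReal_coe_nnreal (p := K), ← ENNReal.ofReal_mul (by positivity),
      ← ENNReal.ofReal_mul (by positivity), ← ENNReal.ofReal_mul (by positivity)]
    congr 1
    field_simp
  have hlim : Tendsto (fun N : ℕ => ENNReal.ofReal (L * K * t ^ 2 / N)) atTop (𝓝 0) := by
    rw [← ENNReal.ofReal_zero]
    exact ENNReal.tendsto_ofReal (tendsto_const_div_atTop_nhds_zero_nat _)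
  exact eq_of_Wg_eq_zero (le_antisymm (ge_of_tendsto hlim hbound) zero_le)

end MDES

theorem theorem2 {n : ℕ} (V : MDES.M n → MDES.TM n) (s : MDES.M n → MDES.M n)
    (hV : MDES.IsPVF V) (hV1 : MDES.SupportSublinear V)
    (hs1 : MDES.SourceLipschitz s) (hs2 : MDES.SourceBoundedSupport s)
    (ε : MDES.M n → ℝ) (γ : MDES.M n → ℝ → MDES.M n)
    (hγ : MDES.IsDiracGerm V 0 ε γ ∨ MDES.IsDiracGerm V s ε γ)
    (T : ℝ) (hT : 0 < T)
    (S₁ S₂ : ℝ → MDES.M n → MDES.M n)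
    (hS₁ : MDES.IsLipschitzSemigroup V s T S₁) (hS₂ : MDES.IsLipschitzSemigroup V s T S₂)
    (hc₁ : MDES.IsCompatible T ε γ S₁) (hc₂ : MDES.IsCompatible T ε γ S₂) :
    ∀ t ∈ Set.Icc 0 T, ∀ μ : MDES.M n, S₁ t μ = S₂ t μ := by
  have hε := hγ.elim (fun h => h.uniform_pos) (fun h => h.uniform_pos)
  exact fun t ht μ => MDES.eq_of_Wg_le_sq hS₁ hS₂
    (fun R hR m hm => MDES.exists_Wg_le_sq hS₁ hS₂ hε hc₁ hc₂ hR hm) ht μ
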